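/- Let $\alpha$ be a positive real algebraic number, let $H$ be the splitting field over $\mathbb{Q}$ of the minimal polynomial of $\alpha$ over $\mathbb{Q}$, and let $h$ be the order of the (finite) torsion subgroup of $H^{\times}$, that is, the number of roots of unity in $H$. Then $\mathrm{Tr}_{\mathbb{Q}(\alpha)/\mathbb{Q}}(\alpha^n)=0$ for infinitely many $n\in\mathbb{N}$ if and only if $\alpha\notin\mathbb{Q}(\alpha^h)$. -/

import Mathlib

open scoped IntermediateField

/-! If `α ∉ F = ℚ(α^h)`, all roots of its minimal polynomial over `F` have modulus `α`, so the
constant term is `±α^d` and the polynomial is `X^d - α^d` with `d ≥ 2`. Then `α` has trace zero over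
`F`, and so does `α^(dk+1)` for every `k`. Conversely, a Skolem–Mahler–Lech argument turns
infinitely many zero traces into a whole progression `a + Nk` of them, which forces `α ∉ ℚ(α^N)`.
Galois theory in the splitting field, whose roots of unity have order dividing `h`, then gives `α ∉
ℚ(α^h)`. -/

theorem Polynomial.norm_eval_le_of_forall_coeff_le {𝕜 : Type*} [NormedField 𝕜]
    [IsUltrametricDist 𝕜] {ε : ℝ} (hε : 0 ≤ ε) (T : Finset 𝕜) (hT : ∀ t ∈ T, ‖t‖ ≤ 1)
    (P : Polynomial 𝕜) (hroot : ∀ t ∈ T, P.eval t = 0)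
    (hP : ∀ i, T.card ≤ i → ‖P.coeff i‖ ≤ ε) {z : 𝕜} (hz : ‖z‖ ≤ 1) : ‖P.eval z‖ ≤ ε := by
  classical
  induction T using Finset.induction_on generalizing P with
  | empty =>
    rw [Polynomial.eval_eq_sum_range]
    refine IsUltrametricDist.norm_sum_le_of_forall_le_of_nonneg hε fun i _ ↦ ?_
    rw [norm_mul, norm_pow]
    exact (mul_le_of_le_one_right (norm_nonneg _) (pow_le_one₀ (norm_nonneg _) hz)).trans
      (hP i (by simp))
  | insert t T ht ih =>
    obtain ⟨Q, rfl⟩ := Polynomial.dvd_iff_isRoot.mpr (hroot t (Finset.mem_insert_self t T))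
    have ht1 := hT t (Finset.mem_insert_self t T)
    -- Dividing by `X - t` keeps the bound: descend from the top degree using `Q_i = P_(i+1) + t
    -- Q_(i+1)`.
    have hQ : ∀ k i, Q.natDegree < i + k → T.card ≤ i → ‖Q.coeff i‖ ≤ ε := by
      intro k
      induction k with
      | zero => intro i hi _; rw [Polynomial.coeff_eq_zero_of_natDegree_lt (by simpa using hi)]; simpa
      | succ k ihk =>
        intro i hi hTi
        have h1 := ihk (i + 1) (by omega) (by omega)
        have h2 := hP (i + 1) (by rw [Finset.card_insert_of_notMem ht]; omega)
        rw [sub_mul, Polynomial.coeff_sub, Polynomial.coeff_X_mul, Polynomial.coeff_C_mul] at h2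
        have h3 : Q.coeff i = (Q.coeff i - t * Q.coeff (i + 1)) + t * Q.coeff (i + 1) := by ring
        rw [h3]
        refine (IsUltrametricDist.norm_add_le_max _ _).trans (max_le h2 ?_)
        rw [norm_mul]
        exact (mul_le_of_le_one_left (norm_nonneg _) ht1).trans h1
    have hQz := ih (fun s hs ↦ hT s (Finset.mem_insert_of_mem hs)) Q
      (fun s hs ↦ by
        have := hroot s (Finset.mem_insert_of_mem hs)
        rw [Polynomial.eval_mul, mul_eq_zero] at this
        refine this.resolve_left ?_
        simp only [Polynomial.eval_sub, Polynomial.eval_X, Polynomial.eval_C, sub_eq_zero]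
        rintro rfl
        exact ht hs)
      (fun i hi ↦ hQ (Q.natDegree + 1) i (by omega) hi)
    rw [Polynomial.eval_mul, norm_mul]
    refine (mul_le_of_le_one_left (norm_nonneg _) ?_).trans hQz
    simp only [Polynomial.eval_sub, Polynomial.eval_X, Polynomial.eval_C]
    rw [sub_eq_add_neg]
    exact (IsUltrametricDist.norm_add_le_max _ _).trans (max_le hz (by rwa [norm_neg]))

/-- By Legendre, `v_p(j!) ≤ j/(p-1) ≤ j/2` for odd `p`. -/
theorem padicNorm_pow_div_factorial_le (p : ℕ) [hp : Fact p.Prime] (hp2 : p ≠ 2) (j : ℕ) :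
    ‖((p : ℚ_[p]) ^ j / (j.factorial : ℚ_[p]))‖ ≤ ((p : ℝ)⁻¹) ^ (j / 2) := by
  have hp0 : (0 : ℝ) < p := by exact_mod_cast hp.out.pos
  have hj : (j.factorial : ℚ_[p]) ≠ 0 := by exact_mod_cast j.factorial_ne_zero
  have hp3 : 2 ≤ p - 1 := by have := hp.out.two_le; omega
  have h1 := sub_one_mul_padicValNat_factorial (p := p) j
  have h2 : 2 * padicValNat p j.factorial ≤ j :=
    ((Nat.mul_le_mul_right _ hp3).trans h1.le).trans (Nat.sub_le _ _)
  have h3 : ‖(j.factorial : ℚ_[p])‖ = (p : ℝ)⁻¹ ^ padicValNat p j.factorial := by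
    rw [Padic.norm_eq_zpow_neg_valuation hj, Padic.valuation_natCast]
    simp
  rw [norm_div, h3, norm_pow, Padic.norm_p, div_le_iff₀ (by positivity), ← pow_add]
  exact pow_le_pow_of_le_one (by positivity)
    (inv_le_one_of_one_le₀ (by exact_mod_cast hp.out.one_le)) (by omega)

/-- The sum is interpolated by polynomials in `k` whose coefficients of index at least `s` have norm
at most `p^(-⌊s/2⌋)`. With `s` zeros this bounds every value; let `s → ∞`. -/
theorem sum_choose_mul_pow_eq_zero_of_infinite (p : ℕ) [hp : Fact p.Prime] (hp2 : p ≠ 2)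
    (c : ℕ → ℤ)
    (hinf : {k : ℕ | ∑ j ∈ Finset.range (k + 1), (k.choose j : ℤ) * p ^ j * c j = 0}.Infinite)
    (n : ℕ) : ∑ j ∈ Finset.range (n + 1), (n.choose j : ℤ) * p ^ j * c j = 0 := by
  have hp1 : (1 : ℝ) < p := by exact_mod_cast hp.out.one_lt
  set f : ℕ → ℤ := fun k ↦ ∑ j ∈ Finset.range (k + 1), (k.choose j : ℤ) * p ^ j * c j with hf
  have key : ∀ s : ℕ, ‖((f n : ℤ) : ℚ_[p])‖ ≤ ((p : ℝ)⁻¹) ^ (s / 2) := by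
    intro s
    obtain ⟨T, hT, hTs⟩ := hinf.exists_subset_card_eq s
    -- Truncating at `m` is exact at `n` and on `T`, since the falling factorial of `k` vanishes for
    -- `j > k`.
    set m := n + T.sup id
    let P : Polynomial ℚ_[p] := ∑ j ∈ Finset.range (m + 1),
      Polynomial.C ((p : ℚ_[p]) ^ j / (j.factorial : ℚ_[p]) * c j) * descPochhammer ℚ_[p] j
    have hP : ∀ k ≤ m, P.eval (k : ℚ_[p]) = (f k : ℤ) := by
      intro k hk
      simp only [P, Polynomial.eval_finsetSum, Polynomial.eval_mul, Polynomial.eval_C,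
        descPochhammer_eval_eq_descFactorial, hf, Int.cast_sum]
      rw [← Finset.sum_subset (Finset.range_mono (Nat.succ_le_succ hk))]
      · refine Finset.sum_congr rfl fun j _ ↦ ?_
        rw [Nat.descFactorial_eq_factorial_mul_choose]
        have hj : (j.factorial : ℚ_[p]) ≠ 0 := by exact_mod_cast j.factorial_ne_zero
        push_cast
        field_simp
      · intro j _ hj
        rw [Nat.descFactorial_eq_zero_iff_lt.mpr (by simpa using hj)]
        simp
    rw [← hP n (Nat.le_add_right _ _)]
    refine Polynomial.norm_eval_le_of_forall_coeff_le (by positivity)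
      (T.map ⟨((↑) : ℕ → ℚ_[p]), Nat.cast_injective⟩) ?_ P ?_ ?_ ?_
    · intro t ht
      obtain ⟨k, -, rfl⟩ := Finset.mem_map.mp ht
      exact_mod_cast Padic.norm_int_le_one (p := p) k
    · intro t ht
      obtain ⟨k, hk, rfl⟩ := Finset.mem_map.mp ht
      have h0 : f k = 0 := hT hk
      have hkm : k ≤ m := (Finset.le_sup (f := id) hk).trans (Nat.le_add_left _ _)
      simp [hP k hkm, h0]
    · intro i hi
      rw [Finset.card_map, hTs] at hi
      rw [Polynomial.finsetSum_coeff]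
      refine IsUltrametricDist.norm_sum_le_of_forall_le_of_nonneg (by positivity) fun j _ ↦ ?_
      rw [Polynomial.coeff_C_mul]
      rcases lt_or_ge j i with hji | hij
      · rw [Polynomial.coeff_eq_zero_of_natDegree_lt (by rwa [descPochhammer_natDegree])]
        simp only [mul_zero, norm_zero]
        positivity
      · have h1 : ‖(descPochhammer ℚ_[p] j).coeff i‖ ≤ 1 := by
          rw [← descPochhammer_map (Int.castRingHom ℚ_[p]), Polynomial.coeff_map]
          exact Padic.norm_int_le_one _
        have h2 : ‖((c j : ℤ) : ℚ_[p])‖ ≤ 1 := Padic.norm_int_le_one _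
        rw [norm_mul, norm_mul]
        refine (mul_le_of_le_one_right (by positivity) h1).trans <|
          (mul_le_of_le_one_right (by positivity) h2).trans <|
          (padicNorm_pow_div_factorial_le p hp2 j).trans ?_
        exact pow_le_pow_of_le_one (by positivity) (inv_le_one_of_one_le₀ hp1.le)
          (Nat.div_le_div_right (hi.trans hij))
    · exact_mod_cast Padic.norm_int_le_one (p := p) n
  have hlim : Filter.Tendsto (fun s : ℕ ↦ ((p : ℝ)⁻¹) ^ s) Filter.atTop (nhds 0) :=
    tendsto_pow_atTop_nhds_zero_of_lt_one (by positivity) (inv_lt_one_of_one_lt₀ hp1)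
  have h0 : ‖((f n : ℤ) : ℚ_[p])‖ ≤ 0 :=
    ge_of_tendsto' hlim fun s ↦ by simpa using key (2 * s)
  exact_mod_cast norm_le_zero_iff.mp h0

theorem IntermediateField.map_mem_adjoin_simple_iff {F K L : Type*} [Field F] [Field K] [Field L]
    [Algebra F K] [Algebra F L] (f : K →ₐ[F] L) (x y : K) : f x ∈ F⟮f y⟯ ↔ x ∈ F⟮y⟯ := by
  have h : F⟮f y⟯ = F⟮y⟯.map f := by rw [IntermediateField.adjoin_map, Set.image_singleton]
  rw [h]
  constructor
  · rintro ⟨z, hz, hzx⟩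
    exact f.injective hzx ▸ hz
  · exact fun hx ↦ ⟨x, hx, rfl⟩

theorem finite_torsion_units_of_numberField (H : Type*) [Field H] [NumberField H] :
    Finite (CommGroup.torsion Hˣ) := by
  have hfin := NumberField.Embeddings.finite_of_norm_le H ℂ 1
  have : Finite {x : H | IsIntegral ℤ x ∧ ∀ φ : H →+* ℂ, ‖φ x‖ ≤ 1} := hfin
  refine Finite.of_injective (β := {x : H | IsIntegral ℤ x ∧ ∀ φ : H →+* ℂ, ‖φ x‖ ≤ 1})
    (fun u ↦ ⟨((u : Hˣ) : H), ?_⟩) ?_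
  · obtain ⟨n, hn, hu⟩ := isOfFinOrder_iff_pow_eq_one.mp u.2
    have hu' : ((u : Hˣ) : H) ^ n = 1 := by rw [← Units.val_pow_eq_pow_val, hu, Units.val_one]
    refine ⟨IsIntegral.of_pow hn (by rw [hu']; exact isIntegral_one), fun φ ↦ ?_⟩
    exact (Complex.norm_eq_one_of_pow_eq_one (by rw [← map_pow, hu', map_one]) hn.ne').le
  · intro u v huv
    exact Subtype.ext (Units.ext (congrArg Subtype.val huv))

theorem infinite_trace_pow_eq_zero {K : Type*} [Field K] [NumberField K] (φ : K →+* ℝ) {x : K}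
    (hx : 0 < φ x) {h : ℕ} (hh : 0 < h) (hxh : x ∉ ℚ⟮x ^ h⟯) :
    {n : ℕ | Algebra.trace ℚ K (x ^ n) = 0}.Infinite := by
  let F := ℚ⟮x ^ h⟯
  have hint : IsIntegral F x := (IsIntegral.of_finite ℚ x).tower_top
  obtain ⟨P, hPdef⟩ : ∃ P : Polynomial F, P = minpoly F x := ⟨_, rfl⟩
  have hPm : P.Monic := hPdef ▸ minpoly.monic hint
  have hdeg : 2 ≤ P.natDegree := by
    rw [hPdef, minpoly.two_le_natDegree_iff hint]
    rintro ⟨y, hy⟩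
    have hyF : (y : K) ∈ F := y.2
    rw [show (y : K) = x from hy] at hyF
    exact hxh hyF
  have hxF : x ^ h ∈ F := IntermediateField.mem_adjoin_simple_self ℚ _
  have hdvd : P ∣ Polynomial.X ^ h - Polynomial.C (⟨x ^ h, hxF⟩ : F) := by
    rw [hPdef]
    refine minpoly.dvd _ _ ?_
    simp [IntermediateField.algebraMap_apply]
  let ψ : F →+* ℂ := Complex.ofRealHom.comp (φ.comp (algebraMap F K))
  have hroots : ∀ r ∈ (P.map ψ).roots, ‖r‖ = φ x := by
    intro r hr
    have hr0 : (P.map ψ).eval r = 0 := (Polynomial.mem_roots'.mp hr).2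
    have h0 := Polynomial.eval_eq_zero_of_dvd_of_eval_eq_zero (Polynomial.map_dvd ψ hdvd) hr0
    have h1 : r ^ h = ((φ x : ℝ) : ℂ) ^ h := by
      simpa [sub_eq_zero, ψ, IntermediateField.algebraMap_apply] using h0
    have h2 : ‖r‖ ^ h = φ x ^ h := by
      rw [← norm_pow, h1, norm_pow, Complex.norm_real, Real.norm_of_nonneg hx.le]
    exact (pow_left_inj₀ (norm_nonneg _) hx.le hh.ne').mp h2
  have hsplit : (P.map ψ).Splits := IsAlgClosed.splits _
  have hnorm : ‖ψ (P.coeff 0)‖ = φ x ^ P.natDegree := by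
    have h1 := hsplit.coeff_zero_eq_prod_roots_of_monic (hPm.map ψ)
    rw [Polynomial.coeff_map] at h1
    rw [h1, norm_mul, norm_pow, norm_neg, norm_one, one_pow, one_mul]
    have h2 : ‖(P.map ψ).roots.prod‖ = ((P.map ψ).roots.map (fun r ↦ ‖r‖)).prod :=
      map_multiset_prod (normHom : ℂ →*₀ ℝ) _
    rw [h2, Multiset.map_congr rfl hroots, Multiset.map_const', Multiset.prod_replicate,
      ← hsplit.natDegree_eq_card_roots, Polynomial.natDegree_map]
  -- The constant term is real under `φ`, so its modulus determines it up to sign.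
  have hxd : x ^ P.natDegree ∈ F := by
    have h1 : |φ (P.coeff 0 : K)| = φ (x ^ P.natDegree) := by
      rw [map_pow, ← hnorm]
      simp [ψ, IntermediateField.algebraMap_apply]
    rcases abs_choice (φ (P.coeff 0 : K)) with h2 | h2
    · rw [h2] at h1
      rw [← φ.injective h1]
      exact (P.coeff 0).2
    · rw [h2, ← map_neg] at h1
      rw [← φ.injective h1]
      exact F.neg_mem (P.coeff 0).2
  have hd0 : P.natDegree ≠ 0 := by omega
  have hP : Polynomial.X ^ P.natDegree - Polynomial.C (⟨x ^ P.natDegree, hxd⟩ : F) = P := by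
    have hdvd' : P ∣ Polynomial.X ^ P.natDegree - Polynomial.C (⟨x ^ P.natDegree, hxd⟩ : F) := by
      nth_rw 1 [hPdef]
      refine minpoly.dvd _ _ ?_
      simp [IntermediateField.algebraMap_apply]
    refine Polynomial.eq_of_monic_of_dvd_of_natDegree_le hPm
      (Polynomial.monic_X_pow_sub_C _ hd0) hdvd' ?_
    rw [Polynomial.natDegree_X_pow_sub_C]
  have htr : Algebra.trace F K x = 0 := by
    rw [trace_eq_finrank_mul_minpoly_nextCoeff, ← hPdef]
    have : P.nextCoeff = 0 := by
      rw [Polynomial.nextCoeff_of_natDegree_pos (by omega)]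
      nth_rw 1 [← hP]
      rw [Polynomial.coeff_sub, Polynomial.coeff_X_pow, Polynomial.coeff_C,
        if_neg (by omega), if_neg (by omega), sub_zero]
    simp [this]
  refine Set.infinite_of_injective_forall_mem (f := fun k : ℕ ↦ P.natDegree * k + 1) ?_ ?_
  · intro a b hab
    simpa [hd0] using hab
  · intro k
    have h1 : x ^ (P.natDegree * k + 1) = ((⟨x ^ P.natDegree, hxd⟩ : F) ^ k) • x := by
      rw [pow_succ, pow_mul, IntermediateField.smul_def]
      simp
    rw [Set.mem_ofPred_eq, ← Algebra.trace_trace (S := F), h1, map_smul, htr, smul_zero, map_zero]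
open scoped NumberField

theorem NumberField.exists_pow_eq_one_add_prime_mul {K : Type*} [Field K] [NumberField K]
    {x : 𝓞 K} (hx : x ≠ 0) : ∃ p : ℕ, p.Prime ∧ p ≠ 2 ∧ ∃ N : ℕ, 0 < N ∧
      ∃ β : 𝓞 K, x ^ N = 1 + p * β := by
  set m := Ideal.absNorm (Ideal.span {x}) with hm
  have hm0 : m ≠ 0 := by simpa [hm, Ideal.absNorm_eq_zero_iff] using hx
  -- A prime this large is odd and prime to the norm of `x`, so `x` is a unit mod `p`.
  obtain ⟨p, hpm, hp⟩ := Nat.exists_infinite_primes (m + 3)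
  have hcop : Nat.Coprime m p :=
    ((Nat.Prime.coprime_iff_not_dvd hp).mpr fun h ↦ by
      have := Nat.le_of_dvd (Nat.pos_of_ne_zero hm0) h; omega).symm
  obtain ⟨y, hy⟩ := Ideal.mem_span_singleton.mp (Ideal.absNorm_mem (Ideal.span {x}))
  obtain ⟨u, v, huv⟩ := Nat.isCoprime_iff_coprime.mpr hcop
  set I : Ideal (𝓞 K) := Ideal.span {(p : 𝓞 K)} with hI
  have hI0 : I ≠ ⊥ := by
    rw [hI, Ne, Ideal.span_singleton_eq_bot]
    exact_mod_cast hp.ne_zero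
  have : Finite (𝓞 K ⧸ I) := Ideal.finiteQuotientOfFreeOfNeBot I hI0
  have hunit : IsUnit (Ideal.Quotient.mk I x) := by
    refine IsUnit.of_mul_eq_one (Ideal.Quotient.mk I (y * u)) ?_
    rw [← map_mul, ← map_one (Ideal.Quotient.mk I), Ideal.Quotient.eq, hI,
      Ideal.mem_span_singleton]
    have h1 : (u : 𝓞 K) * m + v * p = 1 := by exact_mod_cast congrArg (Int.cast : ℤ → 𝓞 K) huv
    refine ⟨-v, ?_⟩
    rw [← hm] at hy
    linear_combination h1 - u * hy
  obtain ⟨w, hw⟩ := hunit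
  refine ⟨p, hp, by omega, orderOf w, orderOf_pos w, ?_⟩
  have h1 : x ^ orderOf w - 1 ∈ I := by
    rw [← Ideal.Quotient.eq, map_pow, ← hw, ← Units.val_pow_eq_pow_val, pow_orderOf_eq_one,
      Units.val_one, map_one]
  obtain ⟨β, hβ⟩ := Ideal.mem_span_singleton.mp h1
  exact ⟨β, by rw [← hβ]; ring⟩

theorem NumberField.exists_progression_trace_pow_eq_zero {K : Type*} [Field K] [NumberField K]
    {x : 𝓞 K} (hx : x ≠ 0) (hinf : {n : ℕ | Algebra.trace ℤ (𝓞 K) (x ^ n) = 0}.Infinite) :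
    ∃ N : ℕ, 0 < N ∧ ∃ a : ℕ, ∀ k : ℕ, Algebra.trace ℤ (𝓞 K) (x ^ (a + N * k)) = 0 := by
  obtain ⟨p, hp, hp2, N, hN, β, hβ⟩ := exists_pow_eq_one_add_prime_mul hx
  have : Fact p.Prime := ⟨hp⟩
  have hexp : ∀ a k : ℕ, Algebra.trace ℤ (𝓞 K) (x ^ (a + N * k)) =
      ∑ j ∈ Finset.range (k + 1),
        (k.choose j : ℤ) * p ^ j * Algebra.trace ℤ (𝓞 K) (x ^ a * β ^ j) := by
    intro a k
    rw [pow_add, pow_mul, hβ, add_comm 1, add_pow, Finset.mul_sum, map_sum]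
    refine Finset.sum_congr rfl fun j _ ↦ ?_
    rw [← smul_eq_mul (_ * _ : ℤ), ← map_smul]
    congr 1
    rw [zsmul_eq_mul]
    push_cast
    ring
  -- Pigeonhole over the residues mod `N`.
  have hex : ∃ a, {k : ℕ | Algebra.trace ℤ (𝓞 K) (x ^ (a + N * k)) = 0}.Infinite := by
    by_contra! hcon
    refine hinf (((Finset.range N).finite_toSet.biUnion fun a _ ↦
      (hcon a).image fun k ↦ a + N * k).subset ?_)
    intro n hn
    refine Set.mem_biUnion (x := n % N) (by simpa using Nat.mod_lt n hN) ⟨n / N, ?_, ?_⟩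
    · simpa only [Set.mem_ofPred_eq, Nat.mod_add_div] using hn
    · exact Nat.mod_add_div n N
  obtain ⟨a, ha⟩ := hex
  refine ⟨N, hN, a, fun k ↦ ?_⟩
  simp only [hexp] at ha ⊢
  exact sum_choose_mul_pow_eq_zero_of_infinite p hp2 _ ha k

theorem IntermediateField.exists_aeval_eq_of_mem_adjoin_simple {F K : Type*} [Field F] [Field K]
    [Algebra F K] [Algebra.IsAlgebraic F K] {x y : K} (hx : x ∈ F⟮y⟯) :
    ∃ q : Polynomial F, Polynomial.aeval y q = x := by
  have h1 : x ∈ F⟮y⟯.toSubalgebra := hx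
  rw [IntermediateField.adjoin_simple_toSubalgebra_of_isAlgebraic
    (Algebra.IsAlgebraic.isAlgebraic y), Algebra.adjoin_singleton_eq_range_aeval] at h1
  exact h1

theorem exists_notMem_adjoin_pow_of_infinite_trace_pow_eq_zero {K : Type*} [Field K]
    [NumberField K] {x : K} (hx : x ≠ 0)
    (hinf : {n : ℕ | Algebra.trace ℚ K (x ^ n) = 0}.Infinite) :
    ∃ N : ℕ, 0 < N ∧ x ∉ ℚ⟮x ^ N⟯ := by
  obtain ⟨m, hm, hint⟩ := IsAlgebraic.exists_integral_multiple
    ((IsFractionRing.isAlgebraic_iff ℤ ℚ K).mpr (Algebra.IsAlgebraic.isAlgebraic (R := ℚ) x))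
  let z : 𝓞 K := ⟨m • x, hint⟩
  have hm' : (m : ℚ) ≠ 0 := by exact_mod_cast hm
  have hz : ∀ n, Algebra.trace ℤ (𝓞 K) (z ^ n) = 0 ↔ Algebra.trace ℚ K (x ^ n) = 0 := by
    intro n
    have h1 : ((z ^ n : 𝓞 K) : K) = ((m : ℚ) ^ n) • x ^ n := by
      change algebraMap (𝓞 K) K (z ^ n) = _
      rw [map_pow (algebraMap (𝓞 K) K) z n, show algebraMap (𝓞 K) K z = m • x from rfl, zsmul_eq_mul, mul_pow,
        Algebra.smul_def, map_pow, map_intCast]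
    rw [← Int.cast_eq_zero (α := ℚ), Algebra.coe_trace_int, h1, map_smul, smul_eq_mul,
      mul_eq_zero_iff_left (pow_ne_zero _ hm')]
  have hz0 : z ≠ 0 := fun h ↦ smul_ne_zero hm hx (congrArg Subtype.val h)
  simp only [← hz] at hinf
  obtain ⟨N, hN, a, ha⟩ := NumberField.exists_progression_trace_pow_eq_zero hz0 hinf
  simp only [hz] at ha
  refine ⟨N, hN, fun hmem ↦ ?_⟩
  -- If `x^(-a)` were a polynomial in `x^N`, the trace of `1` would be a combination of the
  -- vanishing traces.
  obtain ⟨q, hq⟩ := IntermediateField.exists_aeval_eq_of_mem_adjoin_simple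
    (inv_mem (pow_mem hmem a))
  have h0 : Algebra.trace ℚ K (x ^ a * Polynomial.aeval (x ^ N) q) = 0 := by
    rw [Polynomial.aeval_eq_sum_range, Finset.mul_sum, map_sum]
    refine Finset.sum_eq_zero fun k _ ↦ ?_
    rw [mul_smul_comm, map_smul, ← pow_mul, ← pow_add, ha, smul_zero]
  rw [hq, mul_inv_cancel₀ (pow_ne_zero _ hx), ← map_one (algebraMap ℚ K),
    Algebra.trace_algebraMap] at h0
  simp [Module.finrank_pos.ne'] at h0

/-- An automorphism fixing `x^N` multiplies `x` by a root of unity, hence fixes `x^h`, hence fixes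
`x`. -/
theorem mem_adjoin_pow_of_mem_adjoin_pow_card_torsion {F H : Type*} [Field F] [Field H]
    [Algebra F H] [FiniteDimensional F H] [IsGalois F H] {x : H} {N : ℕ} (hN : 0 < N)
    (hx : x ∈ F⟮x ^ Nat.card (CommGroup.torsion Hˣ)⟯) : x ∈ F⟮x ^ N⟯ := by
  rcases eq_or_ne x 0 with rfl | hx0
  · exact zero_mem _
  suffices h : x ∈ (⊥ : IntermediateField F⟮x ^ N⟯ H) by
    obtain ⟨y, hy⟩ := IntermediateField.mem_bot.mp h
    have hyF : (y : H) ∈ F⟮x ^ N⟯ := y.2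
    rwa [show (y : H) = x from hy] at hyF
  rw [IsGalois.mem_bot_iff_fixed]
  intro σ
  have hσN : σ x ^ N = x ^ N := by
    rw [← map_pow]
    exact σ.commutes (⟨x ^ N, IntermediateField.mem_adjoin_simple_self F _⟩ : F⟮x ^ N⟯)
  have hσx : σ x ≠ 0 := by simpa using hx0
  let u : Hˣ := Units.mk0 (σ x / x) (div_ne_zero hσx hx0)
  have hu : u ∈ CommGroup.torsion Hˣ := by
    refine isOfFinOrder_iff_pow_eq_one.mpr ⟨N, hN, Units.ext ?_⟩
    simp [u, div_pow, hσN, hx0]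
  have hu1 : u ^ Nat.card (CommGroup.torsion Hˣ) = 1 :=
    congrArg Subtype.val (pow_card_eq_one' (x := (⟨u, hu⟩ : CommGroup.torsion Hˣ)))
  have hσh : σ (x ^ Nat.card (CommGroup.torsion Hˣ)) = x ^ Nat.card (CommGroup.torsion Hˣ) := by
    have h1 := congrArg Units.val hu1
    simp only [u, Units.val_pow_eq_pow_val, Units.val_mk0, Units.val_one, div_pow] at h1
    rw [map_pow]
    exact (div_eq_one_iff_eq (pow_ne_zero _ hx0)).mp h1
  obtain ⟨q, hq⟩ := IntermediateField.exists_aeval_eq_of_mem_adjoin_simple hx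
  have h2 := Polynomial.aeval_algHom_apply (σ.toAlgHom.restrictScalars F)
    (x ^ Nat.card (CommGroup.torsion Hˣ)) q
  rw [hq] at h2
  change Polynomial.aeval (σ _) q = σ x at h2
  rw [hσh, hq] at h2
  exact h2.symm

theorem mainTheorem4 (α : ℝ) (hpos : 0 < α) (halg : IsAlgebraic ℚ α) (h : ℕ)
    (hh : h = Nat.card (CommGroup.torsion ((minpoly ℚ α).SplittingField)ˣ)) :
    {n : ℕ | Algebra.trace ℚ ℚ⟮α⟯ (IntermediateField.AdjoinSimple.gen ℚ α ^ n) = 0}.Infinite ↔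
      α ∉ ℚ⟮α ^ h⟯ := by
  have hint : IsIntegral ℚ α := halg.isIntegral
  have : FiniteDimensional ℚ ℚ⟮α⟯ := IntermediateField.adjoin.finiteDimensional hint
  have : NumberField ℚ⟮α⟯ := ⟨⟩
  have : NumberField (minpoly ℚ α).SplittingField := ⟨⟩
  have : Polynomial.IsSplittingField ℚ (minpoly ℚ α).SplittingField (minpoly ℚ α) := by
    convert! Polynomial.IsSplittingField.splittingField (minpoly ℚ α)
  have : IsGalois ℚ (minpoly ℚ α).SplittingField :=
    IsGalois.of_separable_splitting_field (minpoly.irreducible hint).separable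
  have := finite_torsion_units_of_numberField (minpoly ℚ α).SplittingField
  set x := IntermediateField.AdjoinSimple.gen ℚ α
  have hxα : algebraMap ℚ⟮α⟯ ℝ x = α := IntermediateField.AdjoinSimple.algebraMap_gen ℚ α
  have hmem (N : ℕ) : α ∈ ℚ⟮α ^ N⟯ ↔ x ∈ ℚ⟮x ^ N⟯ := by
    have h1 := IntermediateField.map_mem_adjoin_simple_iff (ℚ⟮α⟯.val) x (x ^ N)
    rwa [map_pow, show ℚ⟮α⟯.val x = α from hxα] at h1
  rw [hmem]
  constructor
  · intro hinf hx
    have hx0 : x ≠ 0 := by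
      rintro h0
      rw [h0, map_zero] at hxα
      exact hpos.ne hxα
    obtain ⟨N, hN, hxN⟩ := exists_notMem_adjoin_pow_of_infinite_trace_pow_eq_zero hx0 hinf
    obtain ⟨r, hr⟩ : ∃ r : (minpoly ℚ α).SplittingField, Polynomial.aeval r (minpoly ℚ α) = 0 := by
      obtain ⟨r, hr⟩ := (Polynomial.SplittingField.splits (minpoly ℚ α)).exists_eval_eq_zero
        (by rw [Polynomial.degree_map]; exact (minpoly.degree_pos hint).ne')
      exact ⟨r, by rwa [Polynomial.eval_map_algebraMap] at hr⟩
    -- Any root gives an embedding, which preserves and reflects membership in simple extensions.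
    let f : ℚ⟮α⟯ →ₐ[ℚ] (minpoly ℚ α).SplittingField :=
      (IntermediateField.adjoin.powerBasis hint).lift r (by simpa [IntermediateField.minpoly_gen] using hr)
    rw [← IntermediateField.map_mem_adjoin_simple_iff f, map_pow, hh] at hx
    have h1 := mem_adjoin_pow_of_mem_adjoin_pow_card_torsion hN hx
    rw [← map_pow, IntermediateField.map_mem_adjoin_simple_iff] at h1
    exact hxN h1
  · exact infinite_trace_pow_eq_zero (algebraMap ℚ⟮α⟯ ℝ) (by rwa [hxα]) (by rw [hh]; exact Nat.card_pos)
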